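/- Let $k$ be a field of characteristic $0$; a variety means a separated scheme of finite type over $\operatorname{Spec}(k)$ (not necessarily reduced). Let $X$ be a variety over $k$. Let $K_0(var/X)$ be the relative Grothendieck group of varieties over $X$, i.e. the quotient of the free abelian group on isomorphism classes $[Y\to X]$ of morphisms of varieties $Y\to X$ by the subgroup generated by the additivity relations $[Y\to X]=[Z\to Y\to X]+[Y\setminus Z\to Y\to X]$ for all closed subvarieties $Z\subset Y$. Let $Iso^{pr}(var/X)$ be the free abelian group on isomorphism classes of proper morphisms of varieties $[X'\to X]$. Then the canonical homomorphism $Iso^{pr}(var/X)\to K_0(var/X)$, $[X'\to X]\mapsto[X'\to X]$, induces an isomorphism from the quotient of $Iso^{pr}(var/X)$ by the acyclicity relations $$[\emptyset\to X]=0\quad\text{and}\quad[\tilde X'\to X]-[\tilde Z'\to X]=[X'\to X]-[Z'\to X]$$ onto $K_0(var/X)$. Here the second relation is imposed for every cartesian diagram $$\begin{array}{ccccc}\tilde Z'&\longrightarrow&\tilde X'&&\\ \downarrow&&\downarrow{\scriptstyle q}&&\\ Z'&\overset{i}{\longrightarrow}&X'&\longrightarrow&X\end{array}$$ of varieties with $X'\to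 X$ proper, $q$ proper, $i$ a closed embedding, and $q:\tilde X'\setminus\tilde Z'\to X'\setminus Z'$ an isomorphism. -/

import Mathlib

open CategoryTheory AlgebraicGeometry

universe u

namespace RelativeGrothendieck

/-- A variety over the field `k`: a separated scheme of finite type over `Spec k`
(not necessarily reduced), given by its structure morphism `p`. -/
structure IsVariety (k : Type u) [Field k] {X : Scheme.{u}}
    (p : X ⟶ Spec (CommRingCat.of k)) : Prop where
  isSeparated : IsSeparated p
  locallyOfFiniteType : LocallyOfFiniteType p
  quasiCompact : QuasiCompact p

section

variable {k : Type u} [Field k] {X : Scheme.{u}}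

/-- The property of a scheme `Y ⟶ X` over `X` that `Y` is a variety over `k`. -/
def isVar (p : X ⟶ Spec (CommRingCat.of k)) : ObjectProperty (Over X) :=
  fun Y => IsVariety k (Y.hom ≫ p)

/-- The property of a scheme `Y ⟶ X` over `X` that `Y` is a variety over `k` and `Y ⟶ X` is
proper. -/
def isProperVar (p : X ⟶ Spec (CommRingCat.of k)) : ObjectProperty (Over X) :=
  fun Y => IsVariety k (Y.hom ≫ p) ∧ IsProper Y.hom

/-- The category of varieties over `X`. -/
abbrev Var (p : X ⟶ Spec (CommRingCat.of k)) := (isVar p).FullSubcategory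

/-- The category of varieties proper over `X`. -/
abbrev ProperVar (p : X ⟶ Spec (CommRingCat.of k)) := (isProperVar p).FullSubcategory

/-- A variety proper over `X`, regarded as a variety over `X`. -/
def ProperVar.toVar {p : X ⟶ Spec (CommRingCat.of k)} (Y : ProperVar p) : Var p :=
  ⟨Y.obj, Y.property.1⟩

/-- The free abelian group on isomorphism classes of morphisms of varieties `Y ⟶ X`. -/
abbrev IsoVar (p : X ⟶ Spec (CommRingCat.of k)) :=
  FreeAbelianGroup (Quotient (isIsomorphicSetoid (Var p)))

/-- The free abelian group on isomorphism classes of proper morphisms of varieties `Y ⟶ X`. -/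
abbrev IsoPr (p : X ⟶ Spec (CommRingCat.of k)) :=
  FreeAbelianGroup (Quotient (isIsomorphicSetoid (ProperVar p)))

/-- The generator `[Y ⟶ X]` of `IsoVar p`. -/
def varClass {p : X ⟶ Spec (CommRingCat.of k)} (Y : Var p) : IsoVar p :=
  FreeAbelianGroup.of (Quotient.mk (isIsomorphicSetoid (Var p)) Y)

/-- The generator `[Y ⟶ X]` of `IsoPr p`. -/
def properClass {p : X ⟶ Spec (CommRingCat.of k)} (Y : ProperVar p) : IsoPr p :=
  FreeAbelianGroup.of (Quotient.mk (isIsomorphicSetoid (ProperVar p)) Y)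

/-- The open complement of (the image of) a closed immersion. -/
def complement {Z Y : Scheme.{u}} (i : Z ⟶ Y) [IsClosedImmersion i] : Y.Opens :=
  ⟨(Set.range i)ᶜ, i.isClosedEmbedding.isClosed_range.isOpen_compl⟩

/-- The additivity relators `[Y ⟶ X] - [Z ⟶ Y ⟶ X] - [Y ∖ Z ⟶ Y ⟶ X]` for a closed immersion
`i : Z ⟶ Y` (over `X`). Here `Y ∖ Z` is any variety over `X` that is
isomorphic, over `X`, to the open subscheme of `Y` on the complement of `Z`. -/
inductive AddRel (p : X ⟶ Spec (CommRingCat.of k)) : IsoVar p → Prop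
  | mk (Y Z U : Var p) (i : Z.obj ⟶ Y.obj) [IsClosedImmersion i.left]
      (e : U.obj ≅ Over.mk ((complement i.left).ι ≫ Y.obj.hom)) :
      AddRel p (varClass Y - varClass Z - varClass U)

/-- The relative Grothendieck group `K₀(var/X)`. -/
abbrev K0 (p : X ⟶ Spec (CommRingCat.of k)) :=
  IsoVar p ⧸ AddSubgroup.closure {x | AddRel p x}

/-- The acyclicity relators: `[∅ ⟶ X]`, and
`([X̃' ⟶ X] - [Z̃' ⟶ X]) - ([X' ⟶ X] - [Z' ⟶ X])` for every cartesian square (over `X`)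
```
  Z̃' --i'--> X̃'
  |           |
  q'          q
  v           v
  Z' --i-->  X'
```
with `q` proper, `i` a closed immersion, and `q` an isomorphism over `X' ∖ Z'`. In this case
`X̃' ∖ Z̃'` is the preimage of `X' ∖ Z'` under `q`. -/
inductive AcRel (p : X ⟶ Spec (CommRingCat.of k)) : IsoPr p → Prop
  | empty (E : ProperVar p) (h : IsEmpty E.obj.left) : AcRel p (properClass E)
  | square (Xt Zt X' Z' : ProperVar p)
      (i' : Zt.obj ⟶ Xt.obj) (q' : Zt.obj ⟶ Z'.obj)
      (q : Xt.obj ⟶ X'.obj) (i : Z'.obj ⟶ X'.obj)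
      (cart : IsPullback i'.left q'.left q.left i.left)
      [IsProper q.left] [IsClosedImmersion i.left]
      (iso : IsIso (q.left ∣_ complement i.left)) :
      AcRel p ((properClass Xt - properClass Zt) - (properClass X' - properClass Z'))

/-- The quotient of `IsoPr p` by the acyclicity relation. -/
abbrev IsoPrModAc (p : X ⟶ Spec (CommRingCat.of k)) :=
  IsoPr p ⧸ AddSubgroup.closure {x | AcRel p x}

end

end RelativeGrothendieck

/-! The map to `K0` respects acyclicity because the complements of `Z'` in `X'` and of its preimage
are isomorphic. The work lies in the inverse, which needs a class for every variety `Y` over `X`.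

If `Y` is open in some `P` proper over `X`, additivity forces the class `[P] - [P ∖ Y]`. Two choices
of `P` are compared through the closure of `Y` in their fibre product over `X`, which modifies both
only away from `Y` (`clsOpen_eq`). Additivity (`clsOpen_add`) reduces to inclusion-exclusion for two
closed subsets (`clsOn_sup`), itself an instance of the acyclicity relation.

A global compactification of `Y` is avoided. Affine varieties over `X` are compactifiable, being
locally closed in `X` times a projective space. An additive invariant restricts to a modular
function on opens, so inclusion-exclusion over a finite affine cover gives a value independent of
the cover (`listVal_eq`) and still additive (`extend_add`). The two maps are inverse to each other
since `K0` satisfies the same inclusion-exclusion (`toK0_clsVar`) and a proper `Y` is its own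
compactification. -/

namespace RelativeGrothendieck

/-! ### Modular functions on a distributive lattice and inclusion-exclusion. -/

section Valuation

variable {α G : Type*} [DistribLattice α] [BoundedOrder α] [AddCommGroup G]

/-- The join of a list. -/
def listSup (l : List α) : α := l.foldr (· ⊔ ·) ⊥

@[simp] lemma listSup_nil : listSup ([] : List α) = ⊥ := rfl

@[simp] lemma listSup_cons (a : α) (l : List α) : listSup (a :: l) = a ⊔ listSup l := rfl

lemma le_listSup {a : α} {l : List α} (h : a ∈ l) : a ≤ listSup l := by
  induction l with
  | nil => simp at h
  | cons b l ih =>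
    rcases List.mem_cons.mp h with rfl | h
    · exact le_sup_left
    · exact (ih h).trans le_sup_right

lemma listSup_append (l l' : List α) : listSup (l ++ l') = listSup l ⊔ listSup l' := by
  induction l with
  | nil => simp
  | cons a l ih => simp [ih, sup_assoc]

lemma listSup_perm {l l' : List α} (h : l.Perm l') : listSup l = listSup l' := by
  induction h with
  | nil => rfl
  | cons a _ ih => simp [ih]
  | swap a b l => simp [sup_left_comm]
  | trans _ _ h₁ h₂ => exact h₁.trans h₂

/-- The value on `listSup l` that modularity forces on a valuation extending `f`. -/
def listVal (f : α → G) : List α → G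
  | [] => 0
  | a :: l => listVal f l + (f a - f (a ⊓ listSup l))

@[simp] lemma listVal_nil (f : α → G) : listVal f [] = 0 := rfl

@[simp] lemma listVal_cons (f : α → G) (a : α) (l : List α) :
    listVal f (a :: l) = listVal f l + (f a - f (a ⊓ listSup l)) := rfl

/-- `f` is modular on the elements that satisfy `Q`, a property that passes to smaller elements. -/
structure IsModularOn (Q : α → Prop) (f : α → G) : Prop where
  mono : ∀ {a b}, a ≤ b → Q b → Q a
  bot : Q ⊥ → f ⊥ = 0
  modular : ∀ a b, Q (a ⊔ b) → f (a ⊔ b) + f (a ⊓ b) = f a + f b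

variable {Q : α → Prop} {f : α → G}

/-- Only a swap of two entries matters. Modularity applied below each of them expands both sides
into expressions symmetric in the two. -/
lemma IsModularOn.listVal_perm (h : IsModularOn Q f) {l l' : List α} (hp : l.Perm l')
    (hl : ∀ a ∈ l, Q a) : listVal f l = listVal f l' := by
  induction hp with
  | nil => rfl
  | cons a hp ih =>
    simp [ih fun b hb => hl b (List.mem_cons_of_mem _ hb), listSup_perm hp]
  | swap a b l =>
    have ha : Q a := hl a (by simp)
    have hb : Q b := hl b (by simp)
    -- Every term lies below `x`, so `Q x` suffices; nothing is needed of the join of the list.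
    have key : ∀ x y z : α, Q x → f (x ⊓ (y ⊔ z)) + f (x ⊓ y ⊓ z) = f (x ⊓ y) + f (x ⊓ z) := by
      intro x y z hx
      have := h.modular (x ⊓ y) (x ⊓ z) (h.mono (sup_le inf_le_left inf_le_left) hx)
      rwa [← inf_sup_left, ← inf_inf_distrib_left, ← inf_assoc] at this
    have k₁ := key a b (listSup l) ha
    have k₂ := key b a (listSup l) hb
    simp only [listVal_cons, listSup_cons]
    rw [inf_comm b a] at k₂
    have e₁ := eq_sub_of_add_eq k₁
    have e₂ := eq_sub_of_add_eq k₂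
    rw [e₁, e₂]
    abel
  | trans hp₁ _ h₁ h₂ =>
    exact (h₁ hl).trans (h₂ fun a ha => hl a (hp₁.mem_iff.mpr ha))

lemma listVal_append_of_le (f : α → G) (l l' : List α) (h : ∀ a ∈ l', a ≤ listSup l) :
    listVal f (l' ++ l) = listVal f l := by
  induction l' with
  | nil => rfl
  | cons a l' ih =>
    have : a ≤ listSup (l' ++ l) :=
      (h a (by simp)).trans (by rw [listSup_append]; exact le_sup_right)
    simp [ih fun b hb => h b (List.mem_cons_of_mem _ hb), inf_eq_left.mpr this]

/-- Both values equal that of the concatenated list: entries below the join contribute nothing, and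
the order of the two blocks is irrelevant. -/
lemma IsModularOn.listVal_eq (h : IsModularOn Q f) {l l' : List α} (hl : ∀ a ∈ l, Q a)
    (hl' : ∀ a ∈ l', Q a) (e : listSup l = listSup l') : listVal f l = listVal f l' := by
  rw [← listVal_append_of_le f l l' fun a ha => e ▸ le_listSup ha,
    ← listVal_append_of_le f l' l fun a ha => e ▸ le_listSup ha]
  exact h.listVal_perm List.perm_append_comm fun a ha =>
    (List.mem_append.mp ha).elim (hl' a) (hl a)

lemma IsModularOn.listVal_eq_apply (h : IsModularOn Q f) {l : List α} (hl : Q (listSup l)) :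
    listVal f l = f (listSup l) := by
  induction l with
  | nil => exact (h.bot hl).symm
  | cons a l ih =>
    rw [listVal_cons, ih (h.mono le_sup_right hl), listSup_cons]
    have := h.modular a (listSup l) hl
    rw [eq_sub_of_add_eq this]
    abel

lemma listSup_map {β : Type*} [DistribLattice β] [BoundedOrder β] (φ : α → β)
    (hbot : φ ⊥ = ⊥) (hsup : ∀ a b, φ (a ⊔ b) = φ a ⊔ φ b) (l : List α) :
    listSup (l.map φ) = φ (listSup l) := by
  induction l with
  | nil => simp [hbot]
  | cons a l ih => simp [ih, hsup]

lemma map_listVal {G' : Type*} [AddCommGroup G'] (φ : G →+ G') (l : List α) :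
    φ (listVal f l) = listVal (fun a => φ (f a)) l := by
  induction l with
  | nil => simp
  | cons a l ih => simp [ih]

lemma listVal_congr {f' : α → G} (hQ : ∀ {a b}, a ≤ b → Q b → Q a) (hf : ∀ a, Q a → f a = f' a)
    (l : List α) (hl : ∀ a ∈ l, Q a) : listVal f l = listVal f' l := by
  induction l with
  | nil => simp
  | cons a l ih =>
    have ha : Q a := hl a (by simp)
    simp [ih fun b hb => hl b (List.mem_cons_of_mem _ hb), hf a ha, hf _ (hQ inf_le_left ha)]

end Valuation

/-! ### Extending an additive invariant from local pieces to schemes covered by them. -/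

section AdditiveInvariant

variable {X : Scheme.{u}} {G : Type*} [AddCommGroup G]

/-- A property `Q` of schemes over `X` that passes to open and closed subschemes, and an invariant
`c` of schemes over `X` that is additive on those with `Q`. -/
structure IsAdditiveOn (Q : ∀ ⦃Y : Scheme.{u}⦄, (Y ⟶ X) → Prop)
    (c : ∀ ⦃Y : Scheme.{u}⦄, (Y ⟶ X) → G) : Prop where
  closed : ∀ {Z Y : Scheme.{u}} (i : Z ⟶ Y) (g : Y ⟶ X) [IsClosedImmersion i], Q g → Q (i ≫ g)
  opens : ∀ {U Y : Scheme.{u}} (j : U ⟶ Y) (g : Y ⟶ X) [IsOpenImmersion j], Q g → Q (j ≫ g)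
  add : ∀ {Z U Y : Scheme.{u}} (i : Z ⟶ Y) (j : U ⟶ Y) (g : Y ⟶ X) [IsClosedImmersion i]
    [IsOpenImmersion j], Q g → Set.range j = (Set.range i)ᶜ → c g = c (i ≫ g) + c (j ≫ g)

namespace IsAdditiveOn

variable {Q : ∀ ⦃Y : Scheme.{u}⦄, (Y ⟶ X) → Prop} {c : ∀ ⦃Y : Scheme.{u}⦄, (Y ⟶ X) → G}

lemma of_isEmpty (h : IsAdditiveOn Q c) {Y : Scheme.{u}} [IsEmpty Y] (g : Y ⟶ X) (hg : Q g) :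
    c g = 0 := by
  have := h.add (𝟙 Y) (𝟙 Y) g hg (Subsingleton.elim _ _)
  simpa using this

/-- Invariance under isomorphism need not be an axiom: it is additivity with an empty closed part.
-/
lemma of_isIso (h : IsAdditiveOn Q c) {Y Y' : Scheme.{u}} (e : Y' ⟶ Y) [IsIso e] (g : Y ⟶ X)
    (hg : Q g) : c (e ≫ g) = c g := by
  have h₁ := h.closed (Limits.initial.to Y) g hg
  have := h.add (Limits.initial.to Y) e g hg (by
    rw [Set.range_eq_empty (Limits.initial.to Y), Set.compl_empty]
    exact Set.range_eq_univ.mpr e.surjective)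
  rw [this, h.of_isEmpty _ h₁, zero_add]

lemma of_range_eq (h : IsAdditiveOn Q c) {U V Y : Scheme.{u}} (a : U ⟶ Y) (b : V ⟶ Y)
    [IsOpenImmersion a] [IsOpenImmersion b] (e : Set.range a = Set.range b) (g : Y ⟶ X)
    (hg : Q (b ≫ g)) : c (a ≫ g) = c (b ≫ g) := by
  rw [← h.of_isIso (IsOpenImmersion.isoOfRangeEq a b e).hom _ hg,
    IsOpenImmersion.isoOfRangeEq_hom_fac_assoc]

lemma of_opens_le (h : IsAdditiveOn Q c) {Y : Scheme.{u}} (g : Y ⟶ X) {V W : Y.Opens} (e : V ≤ W)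
    (hW : Q (W.ι ≫ g)) : Q (V.ι ≫ g) := by
  rw [← Y.homOfLE_ι e, Category.assoc]
  exact h.opens _ _ hW

/-- Additivity on an open subscheme. -/
lemma add_opens (h : IsAdditiveOn Q c) {Z U Y : Scheme.{u}} (i : Z ⟶ Y) (j : U ⟶ Y) (g : Y ⟶ X)
    [IsClosedImmersion i] [IsOpenImmersion j] (hr : Set.range j = (Set.range i)ᶜ) (W : Y.Opens)
    (hW : Q (W.ι ≫ g)) :
    c (W.ι ≫ g) = c ((i ⁻¹ᵁ W).ι ≫ i ≫ g) + c ((j ⁻¹ᵁ W).ι ≫ j ≫ g) := by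
  have := h.add (i ∣_ W) (j ∣_ W) (W.ι ≫ g) hW (by
    ext x
    have key : ∀ {T : Scheme.{u}} (t : T ⟶ Y), x ∈ Set.range (t ∣_ W) ↔ x.1 ∈ Set.range t := by
      intro T t
      rw [morphismRestrict_base]
      constructor
      · rintro ⟨y, rfl⟩
        exact ⟨y.1, rfl⟩
      · rintro ⟨y, hy⟩
        exact ⟨⟨y, by simpa [hy] using x.2⟩, Subtype.ext hy⟩
    rw [Set.mem_compl_iff, key i, key j, hr, Set.mem_compl_iff])
  rw [this, morphismRestrict_ι_assoc, morphismRestrict_ι_assoc]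

/-- The values on the open subschemes form a modular function. -/
lemma isModularOn (h : IsAdditiveOn Q c) {Y : Scheme.{u}} (g : Y ⟶ X) :
    IsModularOn (fun V : Y.Opens => Q (V.ι ≫ g)) (fun V : Y.Opens => c (V.ι ≫ g)) where
  mono e hW := h.of_opens_le g e hW
  bot hb := by
    have : IsEmpty (⊥ : Y.Opens) := ⟨fun x => x.2⟩
    exact h.of_isEmpty _ hb
  modular V W hQ := by
    -- Cut both `V ⊔ W` and `W` along the closed complement of `V`. The closed parts coincide, and
    -- the open parts are `V` and `V ⊓ W`.
    let C : TopologicalSpace.Closeds Y := ⟨(V : Set Y)ᶜ, V.2.isClosed_compl⟩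
    let i := (Scheme.IdealSheafData.vanishingIdeal C).subschemeι
    have hi : Set.range V.ι = (Set.range i)ᶜ := by
      rw [Scheme.IdealSheafData.range_subschemeι]
      simp [C]
    have hQW : Q (W.ι ≫ g) := h.of_opens_le g le_sup_right hQ
    have hQV : Q (V.ι ≫ g) := h.of_opens_le g le_sup_left hQ
    have h₁ := h.add_opens i V.ι g hi (V ⊔ W) hQ
    have h₂ := h.add_opens i V.ι g hi W hQW
    have e₁ : i ⁻¹ᵁ (V ⊔ W) = i ⁻¹ᵁ W := by
      ext x
      have : i x ∉ (V : Set Y) := by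
        have : i x ∈ Set.range i := ⟨x, rfl⟩
        rw [Scheme.IdealSheafData.range_subschemeι] at this
        simpa [C] using this
      exact or_iff_right this
    have hr : ∀ W' : Y.Opens, Set.range ((V.ι ⁻¹ᵁ W').ι ≫ V.ι) = (V ∩ W' : Set Y) := by
      intro W'
      rw [Scheme.Hom.comp_base, TopCat.coe_comp, Set.range_comp, Scheme.Opens.range_ι]
      exact (Set.image_preimage_eq_range_inter).trans (by rw [Scheme.Opens.range_ι]; rfl)
    have e₁' := congr_arg (fun V : Scheme.Opens _ => c (V.ι ≫ i ≫ g)) e₁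
    have e₂ : c ((V.ι ⁻¹ᵁ (V ⊔ W)).ι ≫ V.ι ≫ g) = c (V.ι ≫ g) := by
      rw [← Category.assoc]
      exact h.of_range_eq _ _ (by rw [hr, Scheme.Opens.range_ι]; simp) g hQV
    have e₃ : c ((V.ι ⁻¹ᵁ W).ι ≫ V.ι ≫ g) = c ((V ⊓ W).ι ≫ g) := by
      rw [← Category.assoc]
      exact h.of_range_eq _ _ (by rw [hr, Scheme.Opens.range_ι]; rfl) g (h.of_opens_le g inf_le_left hQV)
    simp only [h₁, h₂, e₁', e₂, e₃]
    abel

/-- A finite cover by opens with `Q`. -/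
def HasCover (Q : ∀ ⦃Y : Scheme.{u}⦄, (Y ⟶ X) → Prop) {Y : Scheme.{u}} (g : Y ⟶ X) : Prop :=
  ∃ l : List Y.Opens, (∀ V ∈ l, Q (V.ι ≫ g)) ∧ listSup l = ⊤

open Classical in
/-- The extension of an additive invariant to schemes with a finite cover by opens with `Q`. -/
noncomputable def extend (Q : ∀ ⦃Y : Scheme.{u}⦄, (Y ⟶ X) → Prop)
    (c : ∀ ⦃Y : Scheme.{u}⦄, (Y ⟶ X) → G) ⦃Y : Scheme.{u}⦄ (g : Y ⟶ X) : G :=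
  if h : HasCover Q g then listVal (fun V : Y.Opens => c (V.ι ≫ g)) h.choose else 0

lemma extend_eq (h : IsAdditiveOn Q c) {Y : Scheme.{u}} (g : Y ⟶ X) (l : List Y.Opens)
    (hl : ∀ V ∈ l, Q (V.ι ≫ g)) (hl' : listSup l = ⊤) :
    extend Q c g = listVal (fun V : Y.Opens => c (V.ι ≫ g)) l := by
  have hc : HasCover Q g := ⟨l, hl, hl'⟩
  rw [extend, dif_pos hc]
  exact (h.isModularOn g).listVal_eq hc.choose_spec.1 hl (hc.choose_spec.2.trans hl'.symm)

lemma extend_of (h : IsAdditiveOn Q c) {Y : Scheme.{u}} (g : Y ⟶ X) (hg : Q g) :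
    extend Q c g = c g := by
  rw [h.extend_eq g [⊤] (by simpa using h.opens _ g hg) (by simp)]
  have hb : c ((⊥ : Y.Opens).ι ≫ g) = 0 := (h.isModularOn g).bot (h.opens _ g hg)
  have ht : c ((⊤ : Y.Opens).ι ≫ g) = c g := h.of_isIso Y.topIso.hom g hg
  have hi := congr_arg (fun V : Y.Opens => c (V.ι ≫ g)) (top_inf_eq (⊥ : Y.Opens))
  simp [ht, hi, hb]

/-- A cover of `Y` pulls back to covers of `Z` and `U`, and the three inclusion-exclusion sums match
term by term. -/
lemma extend_add (h : IsAdditiveOn Q c) {Z U Y : Scheme.{u}} (i : Z ⟶ Y) (j : U ⟶ Y) (g : Y ⟶ X)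
    [IsClosedImmersion i] [IsOpenImmersion j] (hr : Set.range j = (Set.range i)ᶜ)
    (hg : HasCover Q g) : extend Q c g = extend Q c (i ≫ g) + extend Q c (j ≫ g) := by
  obtain ⟨l, hl, hl'⟩ := hg
  have hs : ∀ {T : Scheme.{u}} (t : T ⟶ Y) (l : List Y.Opens),
      listSup (l.map (t ⁻¹ᵁ ·)) = t ⁻¹ᵁ listSup l :=
    fun t l => listSup_map _ rfl (fun _ _ => rfl) l
  have hi : ∀ V ∈ l.map (i ⁻¹ᵁ ·), Q (V.ι ≫ i ≫ g) := by
    simp only [List.mem_map]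
    rintro _ ⟨V, hV, rfl⟩
    rw [← morphismRestrict_ι_assoc]
    exact h.closed _ _ (hl V hV)
  have hj : ∀ V ∈ l.map (j ⁻¹ᵁ ·), Q (V.ι ≫ j ≫ g) := by
    simp only [List.mem_map]
    rintro _ ⟨V, hV, rfl⟩
    rw [← morphismRestrict_ι_assoc]
    exact h.opens _ _ (hl V hV)
  rw [h.extend_eq g l hl hl', h.extend_eq (i ≫ g) _ hi (by rw [hs, hl']; rfl),
    h.extend_eq (j ≫ g) _ hj (by rw [hs, hl']; rfl)]
  -- The remaining identity holds for every list of opens with `Q`, covering or not, which is what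
  -- makes the induction possible.
  clear hi hj hl'
  induction l with
  | nil => simp
  | cons V l ih =>
    have hV := hl V (by simp)
    have hV' : Q ((V ⊓ listSup l).ι ≫ g) := h.of_opens_le g inf_le_left hV
    simp only [List.map_cons, listVal_cons]
    rw [ih fun W hW => hl W (List.mem_cons_of_mem _ hW), h.add_opens i j g hr V hV,
      h.add_opens i j g hr _ hV']
    have e : ∀ {T : Scheme.{u}} (t : T ⟶ Y),
        c ((t ⁻¹ᵁ V ⊓ listSup (l.map (t ⁻¹ᵁ ·))).ι ≫ t ≫ g) =
          c ((t ⁻¹ᵁ (V ⊓ listSup l)).ι ≫ t ≫ g) :=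
      fun t => congr_arg (fun W : Scheme.Opens _ => c (W.ι ≫ t ≫ g)) (by rw [hs]; rfl)
    rw [e, e]
    abel

end IsAdditiveOn

end AdditiveInvariant

/-! ### Classes of closed subsets modulo acyclicity. -/

open TopologicalSpace Limits

lemma isReduced_subscheme_vanishingIdeal {Y : Scheme.{u}} (C : Closeds Y) :
    IsReduced (Scheme.IdealSheafData.vanishingIdeal C).subscheme := by
  have (U : (Scheme.IdealSheafData.vanishingIdeal C).subschemeCover.openCover.I₀) : IsReduced
      ((Scheme.IdealSheafData.vanishingIdeal C).subschemeCover.openCover.X U) := by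
    let V : Y.affineOpens := U
    have : _root_.IsReduced
        (Γ(Y, V) ⧸ (Scheme.IdealSheafData.vanishingIdeal C).ideal V) := by
      rw [Scheme.IdealSheafData.vanishingIdeal_ideal]
      exact (Ideal.isRadical_iff_quotient_reduced _).mp
        (PrimeSpectrum.isRadical_vanishingIdeal _)
    exact inferInstanceAs (IsReduced (Spec (.of (Γ(Y, V) ⧸
      (Scheme.IdealSheafData.vanishingIdeal C).ideal V))))
  exact IsReduced.of_openCover _
    (Scheme.IdealSheafData.vanishingIdeal C).subschemeCover.openCover

/-- The closed complement of the range of an open immersion. -/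
def boundary {U Y : Scheme.{u}} (j : U ⟶ Y) [IsOpenImmersion j] : Closeds Y :=
  ⟨(Set.range j)ᶜ, j.isOpenEmbedding.isOpen_range.isClosed_compl⟩

/-- The preimage of a closed set. -/
def closedPreimage {Y' Y : Scheme.{u}} (q : Y' ⟶ Y) (C : Closeds Y) : Closeds Y' :=
  C.preimage q.continuous

/-- The range of a closed immersion. -/
def closedRange {Z Y : Scheme.{u}} (i : Z ⟶ Y) [IsClosedImmersion i] : Closeds Y :=
  ⟨Set.range i, i.isClosedEmbedding.isClosed_range⟩

/-- The inclusion of a closed set with its reduced structure. -/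
noncomputable def redι {Y : Scheme.{u}} (C : Closeds Y) :
    (Scheme.IdealSheafData.vanishingIdeal C).subscheme ⟶ Y :=
  (Scheme.IdealSheafData.vanishingIdeal C).subschemeι

instance {Y : Scheme.{u}} (C : Closeds Y) : IsClosedImmersion (redι C) := by
  unfold redι; infer_instance

lemma range_redι {Y : Scheme.{u}} (C : Closeds Y) : Set.range (redι C) = C := by
  rw [redι, Scheme.IdealSheafData.range_subschemeι, Scheme.IdealSheafData.coe_support_vanishingIdeal]

lemma surjective_fst {A B S : Scheme.{u}} (a : A ⟶ S) (b : B ⟶ S)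
    (h : Set.range a ⊆ Set.range b) : Surjective (pullback.fst a b) := by
  constructor
  rw [← Set.range_eq_univ, Scheme.Pullback.range_fst]
  exact Set.eq_univ_of_forall fun x => h ⟨x, rfl⟩

section ProperClass

variable {k : Type u} [Field k] {X : Scheme.{u}} {p : X ⟶ Spec (CommRingCat.of k)}

lemma IsVariety.comp (hX : IsVariety k p) {Y : Scheme.{u}} (f : Y ⟶ X) [IsSeparated f]
    [LocallyOfFiniteType f] [QuasiCompact f] : IsVariety k (f ≫ p) :=
  have := hX.1
  have := hX.2
  have := hX.3
  ⟨inferInstance, inferInstance, inferInstance⟩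

namespace IsVariety

/-- A scheme proper over a variety, as a variety proper over it. -/
def properVar (hX : IsVariety k p) {Y : Scheme.{u}} (f : Y ⟶ X) [IsProper f] : ProperVar p :=
  ⟨Over.mk f, hX.comp f, ‹_›⟩

/-- The class of a scheme proper over `X` modulo the acyclicity relations. -/
def cls (hX : IsVariety k p) {Y : Scheme.{u}} (f : Y ⟶ X) [IsProper f] : IsoPrModAc p :=
  QuotientAddGroup.mk (properClass (hX.properVar f))

variable (hX : IsVariety k p)
include hX

lemma cls_congr {Y : Scheme.{u}} {f f' : Y ⟶ X} [IsProper f] [IsProper f'] (h : f = f') :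
    hX.cls f = hX.cls f' := by
  subst h; rfl

lemma cls_of_isEmpty {Y : Scheme.{u}} [h : IsEmpty Y] (f : Y ⟶ X) [IsProper f] :
    hX.cls f = 0 :=
  (QuotientAddGroup.eq_zero_iff _).mpr (AddSubgroup.subset_closure (AcRel.empty _ h))

lemma cls_square {Y Y' Z : Scheme.{u}} (f : Y ⟶ X) [IsProper f] (q : Y' ⟶ Y) [IsProper q]
    (i : Z ⟶ Y) [IsClosedImmersion i] (h : IsIso (q ∣_ complement i)) :
    hX.cls (q ≫ f) - hX.cls (pullback.fst q i ≫ q ≫ f) = hX.cls f - hX.cls (i ≫ f) := by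
  rw [← sub_eq_zero]
  refine (QuotientAddGroup.eq_zero_iff _).mpr (AddSubgroup.subset_closure ?_)
  exact @AcRel.square _ _ _ p (hX.properVar (q ≫ f)) (hX.properVar (pullback.fst q i ≫ q ≫ f))
    (hX.properVar f) (hX.properVar (i ≫ f)) (Over.homMk (pullback.fst q i))
    (Over.homMk (pullback.snd q i) (by simp [properVar, pullback.condition_assoc]))
    (Over.homMk q) (Over.homMk i) (IsPullback.of_hasPullback q i)
    ‹IsProper q› ‹IsClosedImmersion i› h

/-- This makes classes insensitive to nilpotents. The empty scheme is a modification of `Y` away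
from `Z`, as that complement is empty. -/
lemma cls_of_surjective {Y Z : Scheme.{u}} (f : Y ⟶ X) [IsProper f] (i : Z ⟶ Y)
    [IsClosedImmersion i] [Surjective i] : hX.cls (i ≫ f) = hX.cls f := by
  have hc : IsEmpty (complement i) := ⟨fun x => x.2 (i.surjective x.1)⟩
  have he : IsIso (initial.to Y ∣_ complement i) :=
    isIso_of_isEmpty _
  have hs := hX.cls_square f (initial.to Y) i he
  have : IsEmpty (pullback (initial.to Y) i : Scheme.{u}) :=
    ⟨fun x => isEmptyElim (pullback.fst (initial.to Y) i x)⟩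
  rw [hX.cls_of_isEmpty (_ ≫ f), hX.cls_of_isEmpty (_ ≫ _ ≫ f), sub_zero, eq_comm,
    sub_eq_zero] at hs
  exact hs.symm

/-- The class of a closed subset of a scheme proper over `X`. -/
noncomputable def clsOn {Y : Scheme.{u}} (f : Y ⟶ X) [IsProper f] (C : Closeds Y) :
    IsoPrModAc p :=
  hX.cls (redι C ≫ f)

/-- The fibre product of `Z` and `Z'` over `Y` is a surjective closed subscheme of each. -/
lemma cls_eq_of_range_eq {Y Z Z' : Scheme.{u}} (f : Y ⟶ X) [IsProper f] (i : Z ⟶ Y) (i' : Z' ⟶ Y)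
    [IsClosedImmersion i] [IsClosedImmersion i'] (h : Set.range i = Set.range i') :
    hX.cls (i ≫ f) = hX.cls (i' ≫ f) := by
  have h₁ : Surjective (pullback.fst i i') := surjective_fst i i' h.le
  have h₂ : Surjective (pullback.snd i i') := by
    constructor
    rw [← Set.range_eq_univ, Scheme.Pullback.range_snd]
    exact Set.eq_univ_of_forall fun x => h ▸ ⟨x, rfl⟩
  rw [← hX.cls_of_surjective (i ≫ f) (pullback.fst i i'),
    ← hX.cls_of_surjective (i' ≫ f) (pullback.snd i i')]
  exact hX.cls_congr (by simp [pullback.condition_assoc])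

lemma cls_eq_clsOn {Y Z : Scheme.{u}} (f : Y ⟶ X) [IsProper f] (i : Z ⟶ Y) [IsClosedImmersion i]
    {C : Closeds Y} (h : Set.range i = C) : hX.cls (i ≫ f) = hX.clsOn f C :=
  hX.cls_eq_of_range_eq f i (redι C) (h.trans (range_redι C).symm)

lemma clsOn_eq_zero {Y : Scheme.{u}} (f : Y ⟶ X) [IsProper f] {C : Closeds Y}
    (h : (C : Set Y) = ∅) : hX.clsOn f C = 0 := by
  rw [← hX.cls_eq_clsOn f (initial.to Y) (by rw [h, Set.range_eq_empty])]
  exact hX.cls_of_isEmpty _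

lemma clsOn_comp {Y Z : Scheme.{u}} (f : Y ⟶ X) [IsProper f] (i : Z ⟶ Y) [IsClosedImmersion i]
    (C : Closeds Y) :
    hX.clsOn (i ≫ f) (closedPreimage i C) = hX.clsOn f (closedRange i ⊓ C) := by
  rw [clsOn, hX.cls_congr (Category.assoc _ _ _).symm]
  refine hX.cls_eq_clsOn f _ ?_
  rw [Scheme.Hom.comp_base, TopCat.coe_comp, Set.range_comp, range_redι]
  exact Set.image_preimage_eq_range_inter

/-- Modification away from a closed subset. -/
lemma cls_sub_clsOn {Y Y' : Scheme.{u}} (f : Y ⟶ X) [IsProper f] (q : Y' ⟶ Y) [IsProper q]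
    (C : Closeds Y) (h : IsIso (q ∣_ C.compl)) :
    hX.cls (q ≫ f) - hX.clsOn (q ≫ f) (closedPreimage q C) = hX.cls f - hX.clsOn f C := by
  have hc : complement (redι C) = C.compl := by
    ext x
    simp [complement, range_redι]
  have := hX.cls_square f q (redι C) (by rw [hc]; exact h)
  rw [hX.cls_eq_clsOn (q ≫ f) (pullback.fst q (redι C)) (C := closedPreimage q C)
    (by rw [Scheme.Pullback.range_fst, range_redι]; rfl)] at this
  exact this

/-- The inclusion of `D` into `C ⊔ D` is a modification away from `C`, so acyclicity gives `[D] - [D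
⊓ C] = [C ⊔ D] - [C]`. -/
lemma clsOn_sup {Y : Scheme.{u}} (f : Y ⟶ X) [IsProper f] (C D : Closeds Y) :
    hX.clsOn f (C ⊔ D) + hX.clsOn f (D ⊓ C) = hX.clsOn f C + hX.clsOn f D := by
  let b := redι (C ⊔ D)
  have : IsReduced (Scheme.IdealSheafData.vanishingIdeal (C ⊔ D)).subscheme :=
    isReduced_subscheme_vanishingIdeal _
  let q := pullback.fst b (redι D)
  have hq : Set.range q = b ⁻¹' D := by
    rw [Scheme.Pullback.range_fst, range_redι]
  have hiso : IsIso (q ∣_ (closedPreimage b C).compl) := by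
    have : Surjective (q ∣_ (closedPreimage b C).compl) := by
      constructor
      rw [morphismRestrict_base]
      rintro ⟨x, hx⟩
      have h₁ : b x ∈ ((C ⊔ D : Closeds Y) : Set Y) := by
        rw [← range_redι]; exact ⟨x, rfl⟩
      have h₂ : x ∈ Set.range q := by
        rw [hq]
        exact h₁.resolve_left hx
      obtain ⟨y, rfl⟩ := h₂
      exact ⟨⟨y, hx⟩, rfl⟩
    -- The reduced structure on `C ⊔ D` is essential here.
    exact isIso_of_isClosedImmersion_of_surjective _
  have h := hX.cls_sub_clsOn (b ≫ f) q (closedPreimage b C) hiso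
  rw [hX.clsOn_comp f b C] at h
  have e₁ : hX.cls (q ≫ b ≫ f) = hX.clsOn f D := by
    rw [hX.cls_congr (Category.assoc _ _ _).symm]
    refine hX.cls_eq_clsOn f _ ?_
    rw [Scheme.Pullback.range_fst_comp, range_redι, range_redι]
    exact Set.inter_eq_right.mpr Set.subset_union_right
  have e₂ : hX.clsOn (q ≫ b ≫ f) (closedPreimage q (closedPreimage b C)) =
      hX.clsOn f (D ⊓ C) := by
    rw [hX.clsOn_comp (b ≫ f) q (closedPreimage b C)]
    have : closedRange q ⊓ closedPreimage b C = closedPreimage b (D ⊓ C) := by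
      apply SetLike.coe_injective
      exact congr_arg (· ∩ _) hq
    rw [this, hX.clsOn_comp f b]
    congr 1
    apply SetLike.coe_injective
    refine (congr_arg (· ∩ _) (range_redι (C ⊔ D))).trans ?_
    exact Set.inter_eq_right.mpr fun x hx => Or.inl hx.2
  have e₃ : closedRange b ⊓ C = C := by
    apply SetLike.coe_injective
    refine (congr_arg (· ∩ _) (range_redι (C ⊔ D))).trans ?_
    exact Set.inter_eq_right.mpr Set.subset_union_left
  rw [e₁, e₂, e₃] at h
  change _ = hX.clsOn f (C ⊔ D) - _ at h
  rw [eq_comm, sub_eq_sub_iff_add_eq_add] at h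
  rw [h, add_comm]

end IsVariety

end ProperClass

/-! ### Classes of schemes open in a proper one. -/

section Compactification

/-- The section of the base change of `q` to `Y` defined by `j'` is closed by separatedness and open
because `j'` is. By density its image is everything, so no point of `P'` outside `Y` lies over `Y`.
-/
lemma isIso_pullback_snd {Y P P' : Scheme.{u}} (q : P' ⟶ P) [IsSeparated q] (j : Y ⟶ P)
    (j' : Y ⟶ P') [IsOpenImmersion j] [IsOpenImmersion j'] [IsDominant j'] (h : j' ≫ q = j) :
    IsIso (pullback.snd q j) ∧ q ⁻¹' Set.range j = Set.range j' := by
  let s : Y ⟶ pullback q j := pullback.lift j' (𝟙 Y) (by simpa using h)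
  have hs : s ≫ pullback.snd q j = 𝟙 Y := pullback.lift_snd _ _ _
  have hs' : s ≫ pullback.fst q j = j' := pullback.lift_fst _ _ _
  have : IsClosedImmersion (s ≫ pullback.snd q j) := hs ▸ inferInstance
  have hc : IsClosedImmersion s := .of_comp s (pullback.snd q j)
  have : IsOpenImmersion (s ≫ pullback.fst q j) := hs' ▸ inferInstance
  have ho : IsOpenImmersion s := .of_comp s (pullback.fst q j)
  have happ : ∀ y, pullback.fst q j (s y) = j' y := fun y => by
    rw [← hs', Scheme.Hom.comp_apply]
  have hsurj : Function.Surjective s := by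
    by_contra hn
    obtain ⟨z, hz⟩ := not_forall.mp hn
    have hopen : IsOpen (pullback.fst q j '' (Set.range s)ᶜ) :=
      (pullback.fst q j).isOpenEmbedding.isOpenMap _ s.isClosedEmbedding.isClosed_range.isOpen_compl
    obtain ⟨_, ⟨w, hw, hw'⟩, y, rfl⟩ := j'.denseRange.inter_open_nonempty _ hopen ⟨_, z, hz, rfl⟩
    rw [← happ] at hw'
    exact hw ⟨y, ((pullback.fst q j).isOpenEmbedding.injective hw').symm⟩
  have : Surjective s := ⟨hsurj⟩
  have : IsIso s := IsOpenImmersion.isIso s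
  refine ⟨?_, ?_⟩
  · have : pullback.snd q j = inv s := (IsIso.inv_eq_of_hom_inv_id hs).symm
    rw [this]; infer_instance
  · rw [← Scheme.Pullback.range_fst]
    ext x
    constructor
    · rintro ⟨z, rfl⟩
      obtain ⟨y, rfl⟩ := hsurj z
      exact ⟨y, (happ y).symm⟩
    · rintro ⟨y, rfl⟩
      exact ⟨s y, happ y⟩

lemma range_imageι {Z P : Scheme.{u}} (f : Z ⟶ P) [QuasiCompact f] :
    Set.range f.imageι = closure (Set.range f) := by
  rw [Scheme.Hom.imageι, Scheme.IdealSheafData.range_subschemeι, Scheme.Hom.support_ker]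

variable {k : Type u} [Field k] {X : Scheme.{u}} {p : X ⟶ Spec (CommRingCat.of k)}

lemma IsVariety.noetherianSpace (hX : IsVariety k p) : NoetherianSpace X := by
  have := hX.2
  have := hX.3
  have : IsLocallyNoetherian X := LocallyOfFiniteType.isLocallyNoetherian p
  have : CompactSpace X := QuasiCompact.compactSpace_of_compactSpace p
  have : IsNoetherian X := ⟨⟩
  infer_instance

/-- A scheme over `X` that is open in a scheme proper over `X`. -/
def IsCompactifiable ⦃Y : Scheme.{u}⦄ (g : Y ⟶ X) : Prop :=
  ∃ (P : Scheme.{u}) (f : P ⟶ X) (j : Y ⟶ P), IsProper f ∧ IsOpenImmersion j ∧ j ≫ f = g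

lemma noetherianSpace_of_isOpenImmersion {Y P : Scheme.{u}} (j : Y ⟶ P) [IsOpenImmersion j]
    [NoetherianSpace P] : NoetherianSpace Y :=
  j.isOpenEmbedding.isInducing.noetherianSpace

namespace IsVariety

variable (hX : IsVariety k p)
include hX

lemma noetherianSpace_of_isProper {P : Scheme.{u}} (f : P ⟶ X) [IsProper f] : NoetherianSpace P :=
  (hX.comp f).noetherianSpace

/-- The class of the open subscheme `Y` of `P`. -/
noncomputable def clsOpen {Y P : Scheme.{u}} (f : P ⟶ X) [IsProper f] (j : Y ⟶ P)
    [IsOpenImmersion j] : IsoPrModAc p :=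
  hX.cls f - hX.clsOn f (boundary j)

lemma clsOpen_congr {Y P : Scheme.{u}} {f f' : P ⟶ X} [IsProper f] [IsProper f'] (h : f = f')
    (j : Y ⟶ P) [IsOpenImmersion j] : hX.clsOpen f j = hX.clsOpen f' j := by
  subst h; rfl

lemma clsOpen_of_isDominant {Y P P' : Scheme.{u}} (f : P ⟶ X) [IsProper f] (q : P' ⟶ P)
    [IsProper q] (j : Y ⟶ P) (j' : Y ⟶ P') [IsOpenImmersion j] [IsOpenImmersion j']
    [IsDominant j'] (h : j' ≫ q = j) : hX.clsOpen (q ≫ f) j' = hX.clsOpen f j := by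
  obtain ⟨h₁, h₂⟩ := isIso_pullback_snd q j j' h
  have hc : (boundary j).compl = j.opensRange := by
    ext x
    exact not_not
  have hiso : IsIso (q ∣_ (boundary j).compl) := by
    rw [hc]
    exact ((MorphismProperty.isomorphisms Scheme).arrow_mk_iso_iff
      (morphismRestrictOpensRange q j)).mpr h₁
  have hb : closedPreimage q (boundary j) = boundary j' := by
    apply SetLike.coe_injective
    exact congr_arg compl h₂
  rw [clsOpen, ← hb]
  exact hX.cls_sub_clsOn f q (boundary j) hiso

/-- The scheme-theoretic image of `Y` in the fibre product contains `Y` as a dense open and maps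
properly to both compactifications. -/
lemma clsOpen_eq {Y P₁ P₂ : Scheme.{u}} (f₁ : P₁ ⟶ X) (f₂ : P₂ ⟶ X) [IsProper f₁] [IsProper f₂]
    (j₁ : Y ⟶ P₁) (j₂ : Y ⟶ P₂) [IsOpenImmersion j₁] [IsOpenImmersion j₂]
    (h : j₁ ≫ f₁ = j₂ ≫ f₂) : hX.clsOpen f₁ j₁ = hX.clsOpen f₂ j₂ := by
  have := hX.noetherianSpace_of_isProper f₁
  have := noetherianSpace_of_isOpenImmersion j₁
  let l := pullback.lift j₁ j₂ h
  have : IsImmersion (l ≫ pullback.fst f₁ f₂) := by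
    rw [pullback.lift_fst]; infer_instance
  have : IsImmersion l := .of_comp l (pullback.fst f₁ f₂)
  have h₁ : l ≫ pullback.fst f₁ f₂ = j₁ := pullback.lift_fst _ _ _
  have h₂ : l ≫ pullback.snd f₁ f₂ = j₂ := pullback.lift_snd _ _ _
  rw [← hX.clsOpen_of_isDominant f₁ (l.imageι ≫ pullback.fst f₁ f₂) j₁ l.toImage (by simp [h₁]),
    ← hX.clsOpen_of_isDominant f₂ (l.imageι ≫ pullback.snd f₁ f₂) j₂ l.toImage (by simp [h₂])]
  exact hX.clsOpen_congr (by simp [pullback.condition]) _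

open Classical in
/-- The class of a compactifiable scheme over `X`. -/
noncomputable def clsCompactifiable ⦃Y : Scheme.{u}⦄ (g : Y ⟶ X) : IsoPrModAc p :=
  if h : IsCompactifiable g then
    have := h.choose_spec.choose_spec.choose_spec.1
    have := h.choose_spec.choose_spec.choose_spec.2.1
    hX.clsOpen h.choose_spec.choose h.choose_spec.choose_spec.choose
  else 0

lemma clsCompactifiable_comp {Y P : Scheme.{u}} (f : P ⟶ X) [IsProper f] (j : Y ⟶ P)
    [IsOpenImmersion j] : hX.clsCompactifiable (j ≫ f) = hX.clsOpen f j := by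
  have h : IsCompactifiable (j ≫ f) := ⟨P, f, j, ‹_›, ‹_›, rfl⟩
  rw [clsCompactifiable, dif_pos h]
  have := h.choose_spec.choose_spec.choose_spec.1
  have := h.choose_spec.choose_spec.choose_spec.2.1
  exact hX.clsOpen_eq _ _ _ _ h.choose_spec.choose_spec.choose_spec.2.2

/-- Compactify `Z` by its closure in `P`. The boundary of `U` is the boundary of `Y` together with
this closure, and their intersection is the boundary of `Z`; `clsOn_sup` does the rest. -/
lemma clsOpen_add {Z U Y P : Scheme.{u}} (i : Z ⟶ Y) (j' : U ⟶ Y) (j : Y ⟶ P) (f : P ⟶ X)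
    [IsClosedImmersion i] [IsOpenImmersion j'] [IsOpenImmersion j] [IsProper f]
    [QuasiCompact (i ≫ j)] (h : Set.range j' = (Set.range i)ᶜ) :
    hX.clsOpen f j =
      hX.clsOpen ((i ≫ j).imageι ≫ f) (i ≫ j).toImage + hX.clsOpen f (j' ≫ j) := by
  have hD : Set.range (i ≫ j).imageι = closure (j '' Set.range i) := by
    rw [range_imageι, Scheme.Hom.comp_base, TopCat.coe_comp, Set.range_comp]
  have hDj : ∀ y, j y ∈ Set.range (i ≫ j).imageι ↔ y ∈ Set.range i := by
    intro y
    -- As `Z` is closed in `Y`, its closure in `P` meets `Y` only in `Z`.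
    have := j.isOpenEmbedding.isInducing.closure_eq_preimage_closure_image (Set.range i)
    rw [i.isClosedEmbedding.isClosed_range.closure_eq] at this
    rw [hD, ← Set.mem_preimage, ← this]
  have hb : boundary (j' ≫ j) = boundary j ⊔ closedRange (i ≫ j).imageι := by
    apply SetLike.coe_injective
    change (Set.range (j' ≫ j))ᶜ = (Set.range j)ᶜ ∪ Set.range (i ≫ j).imageι
    rw [Scheme.Hom.comp_base, TopCat.coe_comp, Set.range_comp, h]
    ext x
    by_cases hx : x ∈ Set.range j
    · obtain ⟨y, rfl⟩ := hx
      rw [Set.mem_union, hDj, Set.mem_compl_iff, Set.mem_compl_iff]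
      have := j.isOpenEmbedding.injective.mem_set_image (s := (Set.range i)ᶜ) (a := y)
      simp_all
    · have : x ∉ j '' (Set.range i)ᶜ := fun ⟨y, _, hy⟩ => hx ⟨y, hy⟩
      exact iff_of_true this (Or.inl hx)
  have hb' : boundary (i ≫ j).toImage = closedPreimage (i ≫ j).imageι (boundary j) := by
    apply SetLike.coe_injective
    change (Set.range (i ≫ j).toImage)ᶜ = ((i ≫ j).imageι ⁻¹' Set.range j)ᶜ
    congr 1
    have happ : ∀ z, (i ≫ j).imageι ((i ≫ j).toImage z) = j (i z) := by
      intro z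
      rw [← Scheme.Hom.comp_apply, Scheme.Hom.toImage_imageι, Scheme.Hom.comp_apply]
    ext x
    constructor
    · rintro ⟨z, rfl⟩
      exact ⟨i z, (happ z).symm⟩
    · rintro ⟨y, hy⟩
      obtain ⟨z, rfl⟩ := (hDj y).mp ⟨x, hy.symm⟩
      exact ⟨z, (i ≫ j).imageι.isClosedEmbedding.injective ((happ z).trans hy)⟩
  have hs := hX.clsOn_sup f (boundary j) (closedRange (i ≫ j).imageι)
  rw [clsOpen, clsOpen, clsOpen, hb, hb', hX.clsOn_comp,
    hX.cls_eq_clsOn f (i ≫ j).imageι (C := closedRange (i ≫ j).imageι) rfl,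
    eq_sub_of_add_eq hs]
  abel

lemma isAdditiveOn_clsCompactifiable :
    IsAdditiveOn (IsCompactifiable (X := X)) hX.clsCompactifiable := by
  have qc : ∀ {Z Y P : Scheme.{u}} (i : Z ⟶ Y) (j : Y ⟶ P) (f : P ⟶ X) [IsClosedImmersion i]
      [IsOpenImmersion j] [IsProper f], QuasiCompact (i ≫ j) := by
    intro Z Y P i j f _ _ _
    have := hX.noetherianSpace_of_isProper f
    have := noetherianSpace_of_isOpenImmersion j
    infer_instance
  constructor
  · rintro Z Y i _ _ ⟨P, f, j, _, _, rfl⟩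
    have := qc i j f
    exact ⟨_, (i ≫ j).imageι ≫ f, (i ≫ j).toImage, inferInstance, inferInstance, by simp⟩
  · rintro U Y j' _ _ ⟨P, f, j, _, _, rfl⟩
    exact ⟨P, f, j' ≫ j, ‹_›, inferInstance, by simp⟩
  · rintro Z U Y i j' _ _ _ ⟨P, f, j, _, _, rfl⟩ h
    have := qc i j f
    rw [hX.clsCompactifiable_comp, hX.clsOpen_add i j' j f h, ← hX.clsCompactifiable_comp,
      ← hX.clsCompactifiable_comp]
    simp

end IsVariety

end Compactification

/-! ### Compactifying affine varieties. -/

section Affine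

open MvPolynomial HomogeneousLocalization in
/-- The affine scheme of an algebra of finite type embeds into a projective space. -/
lemma exists_isImmersion_isProper (k R : Type u) [CommRing k] [CommRing R] [Algebra k R]
    [Algebra.FiniteType k R] :
    ∃ (P : Scheme.{u}) (π : P ⟶ Spec (.of k)) (j : Spec (.of R) ⟶ P), IsProper π ∧
      IsImmersion j ∧ j ≫ π = Spec.map (CommRingCat.ofHom (algebraMap k R)) := by
  obtain ⟨n, φ, hφ⟩ := Algebra.FiniteType.iff_quotient_mvPolynomial''.mp ‹Algebra.FiniteType k R›
  let 𝒜 := homogeneousSubmodule (Option (Fin n)) k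
  let _ : GradedAlgebra 𝒜 := MvPolynomial.gradedAlgebra
  -- The homogenizing coordinate. Dehomogenization `ev` sends it to `1`, hence factors through the
  -- chart where `t` is invertible.
  let t : MvPolynomial (Option (Fin n)) k := X none
  have ht : t ∈ 𝒜 1 := isHomogeneous_X k none
  let ev : MvPolynomial (Option (Fin n)) k →ₐ[k] R := aeval fun o => o.elim 1 fun i => φ (X i)
  have hev : ev t = 1 := by simp [ev, t]
  let lift : Localization.Away t →+* R :=
    IsLocalization.Away.lift t (g := ev.toRingHom) (by
      change IsUnit (ev t); rw [hev]; exact isUnit_one)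
  have hlift : ∀ a, lift (algebraMap _ _ a) = ev a := fun a =>
    IsLocalization.Away.lift_eq t _ a
  let ψ : Away 𝒜 t →+* R := lift.comp (algebraMap (Away 𝒜 t) (Localization.Away t))
  have hψ₀ : ∀ a : 𝒜 0, ψ (fromZeroRingHom 𝒜 _ a) = ev a := by
    intro a
    exact hlift a
  have hψ₁ : ∀ i, ∃ a, ψ a = φ (X i) := by
    intro i
    refine ⟨Away.mk 𝒜 ht 1 (X (some i)) (isHomogeneous_X k (some i)), ?_⟩
    let y : MvPolynomial (Option (Fin n)) k := X (some i)
    change lift (Localization.mk y ⟨t ^ 1, 1, rfl⟩) = _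
    have h : lift (Localization.mk y ⟨t ^ 1, 1, rfl⟩) * lift (algebraMap _ _ t) =
        lift (algebraMap _ _ y) := by
      rw [← map_mul, Localization.mk_eq_mk']
      congr 1
      simp
    rw [hlift, hlift, hev, mul_one] at h
    simpa [ev, y] using h
  have hψ : Function.Surjective ψ := by
    intro r
    obtain ⟨f, rfl⟩ := hφ r
    induction f using MvPolynomial.induction_on with
    | C a =>
      refine ⟨fromZeroRingHom 𝒜 _ ⟨C a, isHomogeneous_C _ a⟩, ?_⟩
      rw [hψ₀]
      simp [ev, ← MvPolynomial.algebraMap_eq]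
    | add f g hf hg =>
      obtain ⟨a, ha⟩ := hf
      obtain ⟨b, hb⟩ := hg
      exact ⟨a + b, by simp [ha, hb]⟩
    | mul_X f i hf =>
      obtain ⟨a, ha⟩ := hf
      obtain ⟨b, hb⟩ := hψ₁ i
      exact ⟨a * b, by simp [ha, hb]⟩
  -- Degree zero consists of constants, so `Spec` of it is closed in `Spec k`, and properness of
  -- `Proj` over it yields properness over `k`.
  have hk : Function.Surjective (algebraMap k (𝒜 0)) := by
    rintro ⟨a, ha⟩
    have h₀ : a.totalDegree = 0 := Nat.le_zero.mp (IsHomogeneous.totalDegree_le ha)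
    exact ⟨_, Subtype.ext (totalDegree_eq_zero_iff_eq_C.mp h₀).symm⟩
  have : IsScalarTower k (𝒜 0) (MvPolynomial (Option (Fin n)) k) :=
    ⟨fun a b c => smul_mul_assoc a b.1 c⟩
  have : Algebra.FiniteType (𝒜 0) (MvPolynomial (Option (Fin n)) k) :=
    Algebra.FiniteType.of_restrictScalars_finiteType k _ _
  have : IsClosedImmersion (Spec.map (CommRingCat.ofHom (algebraMap k (𝒜 0)))) :=
    IsClosedImmersion.spec_of_surjective _ hk
  have : IsClosedImmersion (Spec.map (CommRingCat.ofHom ψ)) :=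
    IsClosedImmersion.spec_of_surjective _ hψ
  refine ⟨Proj 𝒜, Proj.toSpecZero 𝒜 ≫ Spec.map (CommRingCat.ofHom (algebraMap k (𝒜 0))),
    Spec.map (CommRingCat.ofHom ψ) ≫ Proj.awayι 𝒜 t ht one_pos, inferInstance, inferInstance, ?_⟩
  rw [Category.assoc, Proj.awayι_toSpecZero_assoc, ← Spec.map_comp, ← Spec.map_comp]
  congr 1
  ext a
  change ψ (fromZeroRingHom 𝒜 _ (algebraMap k (𝒜 0) a)) = _
  rw [hψ₀]
  exact ev.commutes a

variable {k : Type u} [Field k] {X : Scheme.{u}} {p : X ⟶ Spec (CommRingCat.of k)}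

lemma isCompactifiable_of_isAffine {U : Scheme.{u}} [IsAffine U] (g : U ⟶ X)
    (hU : LocallyOfFiniteType (g ≫ p)) : IsCompactifiable g := by
  obtain ⟨P, π, j, _, _, h⟩ : ∃ (P : Scheme.{u}) (π : P ⟶ Spec (.of k)) (j : U ⟶ P), IsProper π ∧
      IsImmersion j ∧ j ≫ π = g ≫ p := by
    obtain ⟨φ, hφ⟩ := Spec.map_surjective (U.isoSpec.inv ≫ g ≫ p)
    have : LocallyOfFiniteType (Spec.map φ) := hφ ▸ inferInstance
    have hft : φ.hom.FiniteType := HasRingHomProperty.Spec_iff.mp this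
    algebraize [φ.hom]
    obtain ⟨P, π, j, h₁, h₂, h₃⟩ := exists_isImmersion_isProper k Γ(U, ⊤)
    refine ⟨P, π, U.isoSpec.hom ≫ j, h₁, inferInstance, ?_⟩
    rw [Category.assoc, ← Iso.eq_inv_comp]
    exact h₃.trans hφ
  have : CompactSpace U := inferInstance
  have : IsLocallyNoetherian U := LocallyOfFiniteType.isLocallyNoetherian (g ≫ p)
  have : IsNoetherian U := ⟨⟩
  -- This map is an immersion because its projection to `P` is one. Its image is closed in the fibre
  -- product, hence proper over `X`.
  let l : U ⟶ pullback p π := pullback.lift g j h.symm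
  have hl : l ≫ pullback.snd p π = j := pullback.lift_snd _ _ _
  have hl' : l ≫ pullback.fst p π = g := pullback.lift_fst _ _ _
  have : IsImmersion (l ≫ pullback.snd p π) := by rw [hl]; infer_instance
  have : IsImmersion l := .of_comp l (pullback.snd p π)
  exact ⟨l.image, l.imageι ≫ pullback.fst p π, l.toImage, inferInstance, inferInstance,
    by simp [hl']⟩

lemma hasCover_isCompactifiable {Y : Scheme.{u}} (g : Y ⟶ X)
    (hY : IsVariety k (g ≫ p)) : IsAdditiveOn.HasCover (IsCompactifiable (X := X)) g := by
  have := hY.2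
  have := hY.noetherianSpace
  obtain ⟨s, he⟩ : ∃ s : Finset Y.affineOpens, ∀ y : Y, ∃ V ∈ s, y ∈ V.1 := by
    obtain ⟨s, hs⟩ := isCompact_univ.elim_finite_subcover (fun V : Y.affineOpens => (V.1 : Set Y))
      (fun V => V.1.2) fun y _ => by
        obtain ⟨V, hV⟩ := Opens.mem_iSup.mp ((iSup_affineOpens_eq_top Y).ge (Opens.mem_top y))
        exact Set.mem_iUnion.mpr ⟨V, hV⟩
    refine ⟨s, fun y => ?_⟩
    simpa using hs (Set.mem_univ y)
  refine ⟨s.toList.map (·.1), ?_, ?_⟩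
  · simp only [List.mem_map]
    rintro _ ⟨V, _, rfl⟩
    have : IsAffine V := V.2
    exact isCompactifiable_of_isAffine (p := p) _ (by rw [Category.assoc]; infer_instance)
  · rw [eq_top_iff]
    intro y _
    obtain ⟨V, hV, hy⟩ := he y
    have : V.1 ≤ listSup (s.toList.map (·.1)) :=
      le_listSup (List.mem_map.mpr ⟨V, by simpa using hV, rfl⟩)
    exact this hy

end Affine

/-! ### The two mutually inverse homomorphisms. -/

section Comparison

variable {k : Type u} [Field k] {X : Scheme.{u}} {p : X ⟶ Spec (CommRingCat.of k)}

open Classical in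
/-- The class in `K₀(var/X)` of a morphism `Y ⟶ X`, zero unless `Y` is a variety. -/
noncomputable def k0Class (p : X ⟶ Spec (CommRingCat.of k)) ⦃Y : Scheme.{u}⦄ (g : Y ⟶ X) : K0 p :=
  if h : IsVariety k (g ≫ p) then QuotientAddGroup.mk (varClass ⟨Over.mk g, h⟩) else 0

lemma k0Class_hom (Y : Var p) : k0Class p Y.obj.hom = QuotientAddGroup.mk (varClass Y) :=
  dif_pos Y.property

lemma isAdditiveOn_k0Class :
    IsAdditiveOn (fun ⦃Y : Scheme.{u}⦄ (g : Y ⟶ X) => IsVariety k (g ≫ p)) (k0Class p) := by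
  have hc : ∀ {Z Y : Scheme.{u}} (i : Z ⟶ Y) (g : Y ⟶ X) [IsClosedImmersion i],
      IsVariety k (g ≫ p) → IsVariety k ((i ≫ g) ≫ p) := by
    intro Z Y i g _ h
    rw [Category.assoc]
    exact h.comp i
  have ho : ∀ {U Y : Scheme.{u}} (j : U ⟶ Y) (g : Y ⟶ X) [IsOpenImmersion j],
      IsVariety k (g ≫ p) → IsVariety k ((j ≫ g) ≫ p) := by
    intro U Y j g _ h
    rw [Category.assoc]
    have := h.noetherianSpace
    have := noetherianSpace_of_isOpenImmersion j
    exact h.comp j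
  refine ⟨hc, ho, ?_⟩
  intro Z U Y i j g _ _ h hr
  let Y' : Var p := ⟨Over.mk g, h⟩
  let Z' : Var p := ⟨Over.mk (i ≫ g), hc i g h⟩
  let U' : Var p := ⟨Over.mk (j ≫ g), ho j g h⟩
  have hr' : Set.range j = Set.range (complement i).ι := by
    rw [hr, Scheme.Opens.range_ι]; rfl
  let e := IsOpenImmersion.isoOfRangeEq j (complement i).ι hr'
  have he : e.hom ≫ (complement i).ι ≫ g = j ≫ g :=
    IsOpenImmersion.isoOfRangeEq_hom_fac_assoc _ _ _ _
  have hrel : AddRel p (varClass Y' - varClass Z' - varClass U') :=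
    @AddRel.mk _ _ _ p Y' Z' U' (Over.homMk i) ‹IsClosedImmersion i›
      (Over.isoMk (f := Over.mk (j ≫ g)) (g := Over.mk ((complement i).ι ≫ g)) e he)
  have := (QuotientAddGroup.eq_zero_iff _).mpr (AddSubgroup.subset_closure hrel)
  rw [QuotientAddGroup.mk_sub, QuotientAddGroup.mk_sub, ← k0Class_hom, ← k0Class_hom,
    ← k0Class_hom, sub_sub, sub_eq_zero] at this
  exact this

lemma k0Class_acyclic {x : IsoPr p} (hx : AcRel p x) (φ : IsoPr p →+ K0 p)
    (hφ : ∀ Y, φ (properClass Y) = k0Class p Y.obj.hom) : φ x = 0 := by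
  have H := isAdditiveOn_k0Class (p := p)
  obtain ⟨E, h⟩ | ⟨Xt, Zt, X', Z', i', q', q, i, cart, iso⟩ := hx
  · rw [hφ]
    exact H.of_isEmpty _ E.property.1
  · have hi' : IsClosedImmersion i'.left :=
      MorphismProperty.of_isPullback cart.flip ‹IsClosedImmersion i.left›
    have h₁ := H.add i.left (complement i.left).ι X'.obj.hom X'.property.1
      (Scheme.Opens.range_ι _)
    have h₂ := H.add i'.left (q.left ⁻¹ᵁ complement i.left).ι Xt.obj.hom Xt.property.1 (by
      rw [Scheme.Opens.range_ι]
      change (q.left ⁻¹' Set.range i.left)ᶜ = _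
      congr 1
      have := Scheme.image_preimage_eq_of_isPullback cart.flip Set.univ
      simpa using this.symm)
    have h₃ : k0Class p ((q.left ⁻¹ᵁ complement i.left).ι ≫ Xt.obj.hom) =
        k0Class p ((complement i.left).ι ≫ X'.obj.hom) := by
      rw [← Over.w q, ← morphismRestrict_ι_assoc]
      exact H.of_isIso _ _ (H.opens _ _ X'.property.1)
    rw [Over.w i] at h₁
    rw [Over.w i', h₃] at h₂
    simp only [map_sub, hφ, h₁, h₂]
    abel

/-- The homomorphism induced by `[Y ⟶ X] ↦ [Y ⟶ X]`. -/
noncomputable def toK0 (p : X ⟶ Spec (CommRingCat.of k)) : IsoPrModAc p →+ K0 p :=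
  QuotientAddGroup.lift _
    (FreeAbelianGroup.lift (Quotient.lift (fun Y : ProperVar p => k0Class p Y.obj.hom) (by
      rintro Y Y' ⟨e⟩
      have e' : Y.obj ≅ Y'.obj := (isProperVar p).ι.mapIso e
      have : IsIso e'.hom.left := inferInstanceAs (IsIso ((Over.forget X).map e'.hom))
      have := isAdditiveOn_k0Class.of_isIso e'.hom.left Y'.obj.hom Y'.property.1
      rwa [Over.w] at this)))
    ((AddSubgroup.closure_le _).mpr fun x hx =>
      k0Class_acyclic hx _ fun Y => FreeAbelianGroup.lift_apply_of _ _)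

lemma toK0_mk (Y : ProperVar p) :
    toK0 p (QuotientAddGroup.mk (properClass Y)) = k0Class p Y.obj.hom :=
  FreeAbelianGroup.lift_apply_of _ _

namespace IsVariety

variable (hX : IsVariety k p)
include hX

/-- The class of a scheme over `X`, computed from a finite cover by compactifiable opens. -/
noncomputable def clsVar ⦃Y : Scheme.{u}⦄ (g : Y ⟶ X) : IsoPrModAc p :=
  IsAdditiveOn.extend (IsCompactifiable (X := X)) hX.clsCompactifiable g

lemma clsVar_add {Z U Y : Scheme.{u}} (i : Z ⟶ Y) (j : U ⟶ Y) (g : Y ⟶ X)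
    [IsClosedImmersion i] [IsOpenImmersion j] (hr : Set.range j = (Set.range i)ᶜ)
    (hg : IsVariety k (g ≫ p)) : hX.clsVar g = hX.clsVar (i ≫ g) + hX.clsVar (j ≫ g) :=
  hX.isAdditiveOn_clsCompactifiable.extend_add i j g hr (hasCover_isCompactifiable g hg)

lemma clsVar_of_isProper {Y : Scheme.{u}} (g : Y ⟶ X) [IsProper g] : hX.clsVar g = hX.cls g := by
  have h : IsCompactifiable g := ⟨Y, g, 𝟙 Y, ‹_›, inferInstance, Category.id_comp g⟩
  rw [clsVar, hX.isAdditiveOn_clsCompactifiable.extend_of g h]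
  have := hX.clsCompactifiable_comp g (𝟙 Y)
  rw [Category.id_comp] at this
  rw [this, clsOpen, hX.clsOn_eq_zero, sub_zero]
  simp [boundary]

lemma clsVar_iso {Y Y' : Scheme.{u}} (e : Y' ⟶ Y) [IsIso e] (g : Y ⟶ X)
    (hg : IsVariety k (g ≫ p)) : hX.clsVar (e ≫ g) = hX.clsVar g := by
  have := hX.clsVar_add (initial.to Y) e g (by
    rw [Set.range_eq_empty (initial.to Y), Set.compl_empty]
    exact Set.range_eq_univ.mpr e.surjective) hg
  rw [this, hX.clsVar_of_isProper (initial.to Y ≫ g), hX.cls_of_isEmpty, zero_add]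

/-- On a compactifiable piece this is additivity in `K0` for `P` and its boundary. In general `toK0`
commutes with inclusion-exclusion, and `k0Class`, modular on all opens, sums to its value on `Y`. -/
lemma toK0_clsVar {Y : Scheme.{u}} (g : Y ⟶ X) (hg : IsVariety k (g ≫ p)) :
    toK0 p (hX.clsVar g) = k0Class p g := by
  have H := isAdditiveOn_k0Class (p := p)
  have hc : ∀ {V : Scheme.{u}} (v : V ⟶ X), IsCompactifiable v →
      toK0 p (hX.clsCompactifiable v) = k0Class p v := by
    rintro V _ ⟨P, f, j, _, _, rfl⟩
    have hcls : ∀ {Z : Scheme.{u}} (f : Z ⟶ X) [IsProper f],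
        toK0 p (hX.cls f) = k0Class p f := fun f _ => toK0_mk _
    have := H.add (redι (boundary j)) j f (hX.comp f) (by
      rw [range_redι]; exact (compl_compl _).symm)
    rw [hX.clsCompactifiable_comp, clsOpen, map_sub, clsOn, hcls, hcls, this]
    abel
  obtain ⟨l, hl, hl'⟩ := hasCover_isCompactifiable g hg
  have hK := H.isModularOn g
  rw [clsVar, hX.isAdditiveOn_clsCompactifiable.extend_eq g l hl hl', map_listVal,
    listVal_congr (hX.isAdditiveOn_clsCompactifiable.isModularOn g).mono
      (f' := fun V : Y.Opens => k0Class p (V.ι ≫ g)) (fun V hV => hc _ hV) l hl,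
    hK.listVal_eq_apply (H.opens _ g hg), hl']
  exact H.of_isIso Y.topIso.hom g hg

/-- The inverse of `toK0`. -/
noncomputable def ofK0 : K0 p →+ IsoPrModAc p :=
  QuotientAddGroup.lift _
    (FreeAbelianGroup.lift (Quotient.lift (fun Y : Var p => hX.clsVar Y.obj.hom) (by
      rintro Y Y' ⟨e⟩
      have e' : Y.obj ≅ Y'.obj := (isVar p).ι.mapIso e
      have : IsIso e'.hom.left := inferInstanceAs (IsIso ((Over.forget X).map e'.hom))
      have := hX.clsVar_iso e'.hom.left Y'.obj.hom Y'.property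
      rwa [Over.w] at this)))
    ((AddSubgroup.closure_le _).mpr (by
      rintro _ ⟨Y, Z, U, i, e⟩
      have h₁ := hX.clsVar_add i.left (complement i.left).ι Y.obj.hom (Scheme.Opens.range_ι _)
        Y.property
      have : IsIso e.inv.left := inferInstanceAs (IsIso ((Over.forget X).map e.inv))
      have h₂ := hX.clsVar_iso e.inv.left U.obj.hom U.property
      rw [Over.w] at h₂
      change _ = 0
      rw [map_sub, map_sub]
      erw [FreeAbelianGroup.lift_apply_of, FreeAbelianGroup.lift_apply_of,
        FreeAbelianGroup.lift_apply_of]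
      change hX.clsVar Y.obj.hom - hX.clsVar Z.obj.hom - hX.clsVar U.obj.hom = 0
      rw [h₁, Over.w i, ← h₂]
      simp))

lemma ofK0_mk (Y : Var p) :
    hX.ofK0 (QuotientAddGroup.mk (varClass Y)) = hX.clsVar Y.obj.hom :=
  FreeAbelianGroup.lift_apply_of _ _

/-- The comparison isomorphism. -/
noncomputable def isoK0 : IsoPrModAc p ≃+ K0 p :=
  (toK0 p).toAddEquiv hX.ofK0
    (by
      apply QuotientAddGroup.addMonoidHom_ext
      apply FreeAbelianGroup.lift_ext
      rintro ⟨Y⟩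
      have := Y.property.2
      change hX.ofK0 (toK0 p (QuotientAddGroup.mk (properClass Y))) =
        QuotientAddGroup.mk (properClass Y)
      have h := k0Class_hom Y.toVar
      rw [toK0_mk, show k0Class p Y.obj.hom = _ from h, ofK0_mk]
      exact hX.clsVar_of_isProper Y.obj.hom)
    (by
      apply QuotientAddGroup.addMonoidHom_ext
      apply FreeAbelianGroup.lift_ext
      rintro ⟨Y⟩
      change toK0 p (hX.ofK0 (QuotientAddGroup.mk (varClass Y))) =
        QuotientAddGroup.mk (varClass Y)
      rw [ofK0_mk, hX.toK0_clsVar _ Y.property, k0Class_hom])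

end IsVariety

end Comparison

end RelativeGrothendieck

theorem mainTheorem8 (k : Type u) [Field k] [CharZero k] (X : Scheme.{u})
    (p : X ⟶ Spec (CommRingCat.of k)) (hX : RelativeGrothendieck.IsVariety k p) :
    ∃ e : RelativeGrothendieck.IsoPrModAc p ≃+ RelativeGrothendieck.K0 p,
      ∀ Y : RelativeGrothendieck.ProperVar p,
        e (QuotientAddGroup.mk (RelativeGrothendieck.properClass Y)) =
          QuotientAddGroup.mk (RelativeGrothendieck.varClass Y.toVar) := by
  exact ⟨hX.isoK0, fun Y => (RelativeGrothendieck.toK0_mk Y).trans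
    (RelativeGrothendieck.k0Class_hom Y.toVar)⟩
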